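/- **Exchangeability of the $N$-particle system.** Let $N, d \in \mathbb{N}$ and $T > 0$, let $f : \mathbb{R} \times \mathbb{R}^d \to \mathbb{R}^d$, $(t,x) \mapsto f_t(x)$, and $\sigma : \mathbb{R} \to \mathbb{R}$, $t \mapsto \sigma_t$, be Borel measurable, and let $\zeta_t(x)$ be jointly Borel measurable in $(t,x)$ and such that for each $t \in [0,T)$, $\zeta_t$ is an everywhere positive, differentiable probability density on $\mathbb{R}^d$ (for instance the marginal densities of a noising diffusion, in either direction of time). Assume that the drift $$b_t(x) = f_t(x) - \sigma_t^2 \nabla \log \zeta_t(x)$$ is locally Lipschitz in $x$, locally uniformly in $t \in [0,T)$: for all $T' < T$ and $R$ there is $L < \infty$ with $\|b_t(x) - b_t(y)\| \le L \|x-y\|$ for all $t \in [0,T']$ and $\|x\|, \|y\| \le R$. Let $(\Omega, \mathcal{F}, (\mathcal{F}_t), \mathbb{P})$ be a filtered probability space, let $B^1, \dots, B^N$ be independent $d$-dimensional standard Wiener processes relative to $(\mathcal{F}_t)$, and let $\mathbf{X}^N_t = (X^1_t, \dots, X^N_t)$, $t\in[0,T]$, be adapted with almost surely continuous paths and solve the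 denoising mean-field SDEs $$dX^{i}_t = \big[f_t(X^{i}_t) - \sigma_t^2 \nabla \log \zeta_t(X^{i}_t)\big]\,dt + \sigma_t\, dB^{i}_t, \qquad 1 \le i \le N, \quad t \in [0,T],$$ where almost surely $\int_0^T \|b_t(X^i_t)\|\,dt < \infty$ and $\int_0^T \sigma_t^2\,dt < \infty$. Assume that the initial states $X^1_0, \dots, X^N_0$ are i.i.d. standard Gaussian vectors in $\mathbb{R}^d$, i.e. $\mathbf{X}^N_0 \sim \mathcal{N}(0, \mathbf{I}_d)^{\otimes N}$. Then for every $t \in (0,T]$ the particles $X^1_t, \dots, X^N_t$ are exchangeable: for every permutation $\tau \in S_N$, $(X^{\tau(1)}_t, \dots, X^{\tau(N)}_t)$ and $(X^1_t, \dots, X^N_t)$ have the same law. In particular, if this law has a density $\varrho^N_t$ with respect to Lebesgue measure on $(\mathbb{R}^d)^N$, then for every $\tau \in S_N$, $\varrho^N_t(x_{\tau(1)}, \dots, x_{\tau(N)}) = \varrho^N_t(x_1, \dots, x_N)$ for almost every $(x_1,\dots,x_N)$. -/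

import Mathlib

open MeasureTheory ProbabilityTheory Filter Topology
open scoped NNReal ENNReal

noncomputable section

namespace MeanFieldSDE

/-- The state space of one particle: `ℝ^d` with the Euclidean norm. -/
abbrev Particle (d : ℕ) : Type := EuclideanSpace ℝ (Fin d)

/-! ### Stochastic integral of a deterministic square-integrable function -/

/-- A real step function `∑ k, c k • 1_{(a k, b k]}` on the half-line. -/
structure StepFunction where
  n : ℕ
  left : Fin n → ℝ≥0
  right : Fin n → ℝ≥0
  left_le_right : ∀ k, left k ≤ right k
  coeff : Fin n → ℝ

/-- The value of the step function at time `s`. -/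
def StepFunction.toFun (g : StepFunction) (s : ℝ) : ℝ :=
  ∑ k, (Set.Ioc (g.left k : ℝ) (g.right k : ℝ)).indicator (fun _ => g.coeff k) s

/-- The elementary stochastic integral of the step function against the process `B` over `[0, t]`,
`∑ k, c k • (B (b k ∧ t) - B (a k ∧ t))`. -/
def StepFunction.integral {d : ℕ} {Ω : Type*} (g : StepFunction) (B : ℝ≥0 → Ω → Particle d)
    (t : ℝ≥0) (ω : Ω) : Particle d :=
  ∑ k, g.coeff k • (B (min (g.right k) t) ω - B (min (g.left k) t) ω)

/-- `I` is (a version of) the stochastic integral `∫_0^t σ_s dB_s` of the deterministic function `σ`: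
`σ` is square-integrable on `[0, t]`, and the elementary integrals of step functions that
approximate `σ` in `L²([0, t])` converge to `I` in `L²(P)`. -/
structure IsStochasticIntegral {d : ℕ} {Ω : Type*} {mΩ : MeasurableSpace Ω} (P : Measure Ω)
    (σ : ℝ → ℝ) (B : ℝ≥0 → Ω → Particle d) (t : ℝ≥0) (I : Ω → Particle d) : Prop where
  memLp : MemLp σ 2 (volume.restrict (Set.Icc (0 : ℝ) t))
  tendsto : ∀ g : ℕ → StepFunction,
    Tendsto (fun n => eLpNorm (fun s => (g n).toFun s - σ s) 2
      (volume.restrict (Set.Icc (0 : ℝ) t))) atTop (𝓝 0) →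
    Tendsto (fun n => eLpNorm (fun ω => (g n).integral B t ω - I ω) 2 P) atTop (𝓝 0)

/-! ### Independent Wiener processes -/

/-- `B 0, …, B (N - 1)` are independent `d`-dimensional standard Wiener processes relative to the
filtration `ℱ`: all the coordinate processes are independent real Brownian motions, the processes
are adapted, and their increments after time `s` are jointly independent of `ℱ s`. -/
structure IsIndepWienerFamily {d N : ℕ} {Ω : Type*} {mΩ : MeasurableSpace Ω} (P : Measure Ω)
    (ℱ : Filtration ℝ≥0 mΩ) (B : Fin N → ℝ≥0 → Ω → Particle d) : Prop where
  brownian : ∀ i k, IsBrownianReal (fun t ω => B i t ω k) P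
  indep : iIndepFun (fun (p : Fin N × Fin d) (ω : Ω) (t : ℝ≥0) => B p.1 t ω p.2) P
  adapted : ∀ i, Adapted ℱ (B i)
  indep_past : ∀ s : ℝ≥0, Indep (ℱ s) (MeasurableSpace.comap
    (fun (ω : Ω) (i : Fin N) (u : ℝ≥0) => B i (s + u) ω - B i s ω) inferInstance) P

/-! ### The denoising mean-field SDEs -/

/-- `ρ` is an everywhere positive, differentiable probability density on `ℝ^d`, so that its score
`∇ log ρ` is defined everywhere. -/
structure IsScoreDensity {d : ℕ} (ρ : Particle d → ℝ) : Prop where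
  pos : ∀ x, 0 < ρ x
  differentiable : Differentiable ℝ ρ
  lintegral_eq_one : ∫⁻ x, ENNReal.ofReal (ρ x) = 1

/-- The drift `f_t(x) - σ_t² ∇ log ζ_t(x)` of the denoising mean-field SDEs. -/
def denoisingDrift {d : ℕ} (f : ℝ → Particle d → Particle d) (σ : ℝ → ℝ)
    (ζ : ℝ → Particle d → ℝ) (t : ℝ) (x : Particle d) : Particle d :=
  f t x - (σ t) ^ 2 • gradient (fun y => Real.log (ζ t y)) x

/-- `X 0, …, X (N - 1)` solve on `[0, T]` the denoising mean-field SDEs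
`dX^i_t = [f_t(X^i_t) - σ_t² ∇ log ζ_t(X^i_t)] dt + σ_t dB^i_t`: they are adapted, have almost surely
continuous paths and integrable drift, and for each `t ≤ T` the difference
`X^i_t - X^i_0 - ∫_0^t (drift) ds` is the stochastic integral `∫_0^t σ_s dB^i_s`. -/
structure IsDenoisingSolution {d N : ℕ} {Ω : Type*} {mΩ : MeasurableSpace Ω} (P : Measure Ω)
    (ℱ : Filtration ℝ≥0 mΩ) (T : ℝ≥0) (f : ℝ → Particle d → Particle d) (σ : ℝ → ℝ)
    (ζ : ℝ → Particle d → ℝ) (B X : Fin N → ℝ≥0 → Ω → Particle d) : Prop where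
  wiener : IsIndepWienerFamily P ℱ B
  adapted : ∀ i, Adapted ℱ (X i)
  continuousOn : ∀ i, ∀ᵐ ω ∂P, ContinuousOn (fun t => X i t ω) (Set.Iic T)
  integrableOn : ∀ i, ∀ᵐ ω ∂P, IntegrableOn
    (fun s : ℝ => denoisingDrift f σ ζ s (X i s.toNNReal ω)) (Set.Icc (0 : ℝ) T)
  equation : ∀ i, ∀ t ≤ T, IsStochasticIntegral P σ (B i) t (fun ω =>
    X i t ω - X i 0 ω - ∫ s in (0 : ℝ)..t, denoisingDrift f σ ζ s (X i s.toNNReal ω))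

/-! ### Exchangeability -/

/-- The random variables `Y i` are exchangeable: permuting them does not change their joint law. -/
def Exchangeable {ι Ω E : Type*} [MeasurableSpace E] {mΩ : MeasurableSpace Ω} (P : Measure Ω)
    (Y : ι → Ω → E) : Prop :=
  ∀ τ : Equiv.Perm ι, IdentDistrib (fun ω i => Y (τ i) ω) (fun ω i => Y i ω) P P

end MeanFieldSDE

end

namespace MeanFieldSDE

/-! ### Measurability of the drift -/

/-! The noise is additive: `X^i_t - ∫_0^t b_s(X^i_s) ds` equals `X^i_0 + ∫_0^t σ dB^i`. The
integrand `σ` is deterministic, so the stochastic integral is a limit of elementary integrals and is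
given by one measurable functional of the increments of `B^i`, the same for every particle
(`exists_measurable_functional`). The pair of initial states and increments has a
permutation-invariant law (`identDistrib_prodMk`), hence so do the noise terms at countably many
dense times.

It remains to pass from noise terms to paths. Since the drift is only locally Lipschitz, some noise
paths may lead to explosion, so no solution map is constructed. Instead, Grönwall's inequality makes
the map from a path to its noise terms injective on paths with integrable drift (`injOn_noiseTerm`),
and by Lusin-Souslin a measurable injection lets the law of the image determine the law of the path
(`identDistrib_of_injOn_comp`). Evaluation at `t` gives exchangeability. The symmetry of a density
follows from its almost everywhere uniqueness, as permuting coordinates preserves volume. -/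

lemma measurable_fderiv_log_apply {d : ℕ} {T : ℝ} {ζ : ℝ → Particle d → ℝ}
    (hζ : Measurable (Function.uncurry ζ))
    (hζ_density : ∀ t : ℝ, 0 ≤ t → t < T → IsScoreDensity (ζ t)) (v : Particle d) :
    Measurable ((Set.Ico 0 T ×ˢ Set.univ).indicator
      fun p : ℝ × Particle d => fderiv ℝ (fun y => Real.log (ζ p.1 y)) p.2 v) := by
  have hS : MeasurableSet (Set.Ico 0 T ×ˢ (Set.univ : Set (Particle d))) :=
    measurableSet_Ico.prod MeasurableSet.univ
  -- A directional derivative is the limit of difference quotients with step `1/n`, each jointly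
  -- measurable in time and space. The indicator confines the limit to times at which `ζ` is
  -- positive and differentiable.
  refine measurable_of_tendsto_metrizable (f := fun n : ℕ => (Set.Ico 0 T ×ˢ Set.univ).indicator
    fun p : ℝ × Particle d => (n : ℝ) • (Real.log (ζ p.1 (p.2 + (n : ℝ)⁻¹ • v)) -
      Real.log (ζ p.1 p.2))) (fun n => ?_) ?_
  · refine Measurable.indicator ?_ hS
    have h1 : Measurable fun p : ℝ × Particle d => ζ p.1 (p.2 + (n : ℝ)⁻¹ • v) :=
      hζ.comp (measurable_fst.prodMk (measurable_snd.add_const _))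
    have h2 : Measurable fun p : ℝ × Particle d => ζ p.1 p.2 := hζ
    exact ((Real.measurable_log.comp h1).sub (Real.measurable_log.comp h2)).const_smul (n : ℝ)
  · refine tendsto_pi_nhds.2 fun p => ?_
    by_cases hp : p ∈ Set.Ico 0 T ×ˢ (Set.univ : Set (Particle d))
    · simp only [Set.indicator_of_mem hp]
      have hρ := hζ_density p.1 hp.1.1 hp.1.2
      have hd : DifferentiableAt ℝ (fun y => Real.log (ζ p.1 y)) p.2 :=
        (hρ.differentiable p.2).log (hρ.pos p.2).ne'
      exact hd.hasFDerivAt.lim v (by simpa using tendsto_natCast_atTop_atTop)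
    · simp only [Set.indicator_of_notMem hp]
      exact tendsto_const_nhds

lemma measurable_indicator_denoisingDrift {d : ℕ} {T : ℝ} {f : ℝ → Particle d → Particle d}
    {σ : ℝ → ℝ} {ζ : ℝ → Particle d → ℝ}
    (hf : Measurable (Function.uncurry f)) (hσ : Measurable σ)
    (hζ : Measurable (Function.uncurry ζ))
    (hζ_density : ∀ t : ℝ, 0 ≤ t → t < T → IsScoreDensity (ζ t)) :
    Measurable ((Set.Ico 0 T ×ˢ Set.univ).indicator
      fun p : ℝ × Particle d => denoisingDrift f σ ζ p.1 p.2) := by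
  have hS : MeasurableSet (Set.Ico 0 T ×ˢ (Set.univ : Set (Particle d))) :=
    measurableSet_Ico.prod MeasurableSet.univ
  have hgrad : Measurable ((Set.Ico 0 T ×ˢ Set.univ).indicator
      fun p : ℝ × Particle d => gradient (fun y => Real.log (ζ p.1 y)) p.2) := by
    refine (MeasurableEquiv.toLp 2 (Fin d → ℝ)).symm.measurableEmbedding.measurable_comp_iff.1
      (measurable_pi_lambda _ fun k => ?_)
    convert measurable_fderiv_log_apply hζ hζ_density (EuclideanSpace.single k 1) using 1
    ext p
    by_cases hp : p ∈ Set.Ico 0 T ×ˢ (Set.univ : Set (Particle d))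
    · simp only [Function.comp_apply, Set.indicator_of_mem hp]
      rw [← inner_gradient_left, EuclideanSpace.inner_single_right]
      simp
    · simp [Set.indicator_of_notMem hp]
  have hsmul : Measurable fun p : ℝ × Particle d => (σ p.1 ^ 2) •
      (Set.Ico 0 T ×ˢ Set.univ).indicator
        (fun p : ℝ × Particle d => gradient (fun y => Real.log (ζ p.1 y)) p.2) p :=
    ((hσ.comp measurable_fst).pow_const 2).smul hgrad
  convert (hf.indicator hS).sub hsmul using 1
  ext1 p
  by_cases hp : p ∈ Set.Ico 0 T ×ˢ (Set.univ : Set (Particle d))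
  · simp [Set.indicator_of_mem hp, denoisingDrift, Function.uncurry]
  · simp [Set.indicator_of_notMem hp]

/-! ### Uniqueness for the integral equation -/

/-- Two continuous paths with the same noise term `x t - ∫_0^t b s (x s) ds` agree, if `b` is locally
Lipschitz in space, locally uniformly in time. -/
lemma eqOn_of_sub_integral_eq {E : Type*} [NormedAddCommGroup E] [NormedSpace ℝ E]
    {T : ℝ} (hT : 0 < T) {b : ℝ → E → E}
    (hb : ∀ T' : ℝ, T' < T → ∀ R : ℝ, ∃ L : ℝ≥0, ∀ t ∈ Set.Icc (0 : ℝ) T',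
      LipschitzOnWith L (b t) (Metric.closedBall 0 R))
    {x y : ℝ → E} (hx : Continuous x) (hy : Continuous y)
    (hxi : IntegrableOn (fun s => b s (x s)) (Set.Icc 0 T))
    (hyi : IntegrableOn (fun s => b s (y s)) (Set.Icc 0 T))
    (h : ∀ t ∈ Set.Icc 0 T, x t - ∫ s in (0 : ℝ)..t, b s (x s) =
      y t - ∫ s in (0 : ℝ)..t, b s (y s)) :
    Set.EqOn x y (Set.Icc 0 T) := by
  have hIco : Set.EqOn x y (Set.Ico 0 T) := by
    intro T' hT'
    obtain ⟨Cx, hCx⟩ := (isCompact_Icc (a := (0 : ℝ)) (b := T')).exists_bound_of_continuousOn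
      hx.continuousOn
    obtain ⟨Cy, hCy⟩ := (isCompact_Icc (a := (0 : ℝ)) (b := T')).exists_bound_of_continuousOn
      hy.continuousOn
    -- Both paths stay in a common ball up to time `T'`, so a single Lipschitz constant serves
    -- there.
    obtain ⟨L, hL⟩ := hb T' hT'.2 (max Cx Cy)
    have hu : Continuous fun s => ‖x s - y s‖ := (hx.sub hy).norm
    -- Grönwall is applied to this primitive, since `‖x - y‖` itself need not be differentiable; the
    -- bound then reads `u' ≤ L u` with `u 0 = 0`.
    set u : ℝ → ℝ := fun t => ∫ s in (0 : ℝ)..t, ‖x s - y s‖ with hu_def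
    have hud : ∀ t, HasDerivAt u ‖x t - y t‖ t := fun t =>
      intervalIntegral.integral_hasDerivAt_right (hu.intervalIntegrable _ _)
        (hu.stronglyMeasurableAtFilter _ _) hu.continuousAt
    have hint : ∀ {z : ℝ → E}, IntegrableOn (fun s => b s (z s)) (Set.Icc 0 T) →
        ∀ t ∈ Set.Icc 0 T', IntervalIntegrable (fun s => b s (z s)) volume 0 t := by
      intro z hz t ht
      rw [intervalIntegrable_iff_integrableOn_Icc_of_le ht.1]
      exact hz.mono_set (Set.Icc_subset_Icc_right (ht.2.trans hT'.2.le))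
    have hbound : ∀ t ∈ Set.Icc 0 T', ‖x t - y t‖ ≤ L * u t := by
      intro t ht
      have h1 : x t - y t = ∫ s in (0 : ℝ)..t, (b s (x s) - b s (y s)) := by
        rw [intervalIntegral.integral_sub (hint hxi t ht) (hint hyi t ht)]
        have := h t ⟨ht.1, ht.2.trans hT'.2.le⟩
        rw [sub_eq_sub_iff_sub_eq_sub] at this
        exact this
      rw [h1, hu_def, ← intervalIntegral.integral_const_mul]
      refine intervalIntegral.norm_integral_le_of_norm_le ht.1 ?_
        ((hu.const_mul _).intervalIntegrable _ _)
      refine ae_of_all _ fun s hs => ?_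
      have hs' : s ∈ Set.Icc 0 T' := ⟨hs.1.le, hs.2.trans ht.2⟩
      exact (hL s hs').norm_sub_le (by simpa using Or.inl (hCx s hs'))
        (by simpa using Or.inr (hCy s hs'))
    have hu0 : ∀ t, 0 ≤ t → 0 ≤ u t := fun t ht =>
      intervalIntegral.integral_nonneg ht fun _ _ => norm_nonneg _
    have hzero := norm_le_gronwallBound_of_norm_deriv_right_le (f := u) (δ := 0) (K := L) (ε := 0)
      (a := 0) (b := T') (fun t _ => (hud t).continuousAt.continuousWithinAt)
      (fun t _ => (hud t).hasDerivWithinAt) (by simp [hu_def])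
      (fun t ht => by
        rw [norm_norm, Real.norm_of_nonneg (hu0 t ht.1), add_zero]
        exact hbound t ⟨ht.1, ht.2.le⟩) T' (Set.right_mem_Icc.2 hT'.1)
    have hT'mem : T' ∈ Set.Icc 0 T' := Set.right_mem_Icc.2 hT'.1
    have hu' : u T' = 0 := by simpa [gronwallBound_ε0] using hzero
    have := hbound T' hT'mem
    rw [hu', mul_zero] at this
    exact sub_eq_zero.1 (norm_le_zero_iff.1 this)
  -- No Lipschitz bound reaches the endpoint `T`; continuity of the paths does.
  have := hIco.closure hx hy
  rwa [closure_Ico hT.ne] at this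

/-! ### Density of step functions -/

/-- The step function that interpolates `g` on `(0, t]` at the right ends of `n` equal intervals. -/
noncomputable def StepFunction.interpolate (g : ℝ → ℝ) (t : ℝ≥0) (n : ℕ) : StepFunction where
  n := n
  left k := (k : ℝ≥0) * (t / n)
  right k := ((k : ℝ≥0) + 1) * (t / n)
  left_le_right k := by gcongr; simp
  coeff k := g (((k : ℝ) + 1) * (t / n))

lemma StepFunction.interpolate_toFun (g : ℝ → ℝ) {t : ℝ≥0} {n : ℕ} (hn : 0 < n) {s : ℝ}
    (hs : s ∈ Set.Ioc (0 : ℝ) t) :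
    ∃ r ∈ Set.Icc (0 : ℝ) t, |r - s| ≤ t / n ∧ (interpolate g t n).toFun s = g r := by
  have ht : (0 : ℝ) < t := hs.1.trans_le hs.2
  have hn' : (0 : ℝ) < n := by exact_mod_cast hn
  have hδ : (0 : ℝ) < t / n := by positivity
  -- The step intervals are level sets of a ceiling, so exactly one of them contains `s`.
  have hmem : ∀ k : ℕ, s ∈ Set.Ioc ((k : ℝ) * (t / n)) ((k + 1) * (t / n)) ↔
      ⌈s / (t / n)⌉₊ = k + 1 := by
    intro k
    rw [Nat.ceil_eq_iff (by simp), Set.mem_Ioc, lt_div_iff₀ hδ, div_le_iff₀ hδ]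
    push_cast
    simp
  obtain ⟨k, hk⟩ : ∃ k, ⌈s / (t / n)⌉₊ = k + 1 :=
    Nat.exists_eq_succ_of_ne_zero (Nat.ceil_pos.2 (div_pos hs.1 hδ)).ne'
  have hkn : k < n := by
    have : ⌈s / (t / n)⌉₊ ≤ n := by
      rw [Nat.ceil_le, div_le_iff₀ hδ]
      field_simp
      exact hs.2
    omega
  have hks := (hmem k).2 hk
  have hright : ((k : ℝ) + 1) * (t / n) ≤ t := by
    have : (k : ℝ) + 1 ≤ n := by exact_mod_cast hkn
    calc ((k : ℝ) + 1) * (t / n) ≤ n * (t / n) := by gcongr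
      _ = t := by field_simp
  refine ⟨(k + 1) * (t / n), ⟨by positivity, hright⟩, ?_, ?_⟩
  · rw [abs_of_nonneg (by linarith [hks.2])]
    nlinarith [hks.1]
  · refine (Finset.sum_eq_single (⟨k, hkn⟩ : Fin n) ?_ ?_).trans ?_
    · rintro ⟨j, hj⟩ - hjk
      simp only [interpolate]
      push_cast
      refine Set.indicator_of_notMem (fun hjs => hjk ?_) _
      have := (hmem j).1 hjs
      simp only [Fin.mk.injEq]
      omega
    · exact fun hk' => absurd (Finset.mem_univ _) hk'
    · simp only [interpolate]
      push_cast
      rw [Set.indicator_of_mem hks]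

/-- Continuous functions are dense in `L²`, and on a compact interval they are uniformly continuous,
so fine interpolation is uniformly close; finite measure turns this into `L²` closeness. -/
lemma exists_stepFunction_eLpNorm_sub_le {σ : ℝ → ℝ} {t : ℝ≥0}
    (hσ : MemLp σ 2 (volume.restrict (Set.Icc (0 : ℝ) t))) {ε : ℝ≥0∞} (hε : ε ≠ 0) :
    ∃ g : StepFunction,
      eLpNorm (fun s => g.toFun s - σ s) 2 (volume.restrict (Set.Icc (0 : ℝ) t)) ≤ ε := by
  -- The point `0` lies in no step interval and is discarded as a null set.
  rw [← restrict_Ioc_eq_restrict_Icc] at hσ ⊢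
  set μ := volume.restrict (Set.Ioc (0 : ℝ) t) with hμ
  obtain ⟨δ, hδ, hδε⟩ := exists_Lp_half ℝ μ 2 hε
  obtain ⟨g, -, hgσ, hg, hgm⟩ := hσ.exists_hasCompactSupport_eLpNorm_sub_le (by simp) hδ.ne'
  have huc := (isCompact_Icc (a := (0 : ℝ)) (b := t)).uniformContinuousOn_of_continuous
    hg.continuousOn
  obtain ⟨η, hη, hηδ⟩ : ∃ η : ℝ, 0 < η ∧ μ Set.univ ^ (2 : ℝ≥0∞).toReal⁻¹ * ENNReal.ofReal η ≤ δ := by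
    have hlim : Tendsto (fun η : ℝ => μ Set.univ ^ (2 : ℝ≥0∞).toReal⁻¹ * ENNReal.ofReal η)
        (𝓝[>] 0) (𝓝 0) := by
      have h0 : Tendsto (fun η : ℝ => ENNReal.ofReal η) (𝓝[>] 0) (𝓝 0) := by
        simpa using (ENNReal.continuous_ofReal.tendsto (0 : ℝ)).mono_left nhdsWithin_le_nhds
      simpa using ENNReal.Tendsto.const_mul h0 (Or.inr (by simp [hμ]))
    have := (hlim.eventually (ge_mem_nhds hδ)).and self_mem_nhdsWithin
    obtain ⟨η, h1, h2⟩ := this.exists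
    exact ⟨η, h2, h1⟩
  obtain ⟨r, hr, hrη⟩ := Metric.uniformContinuousOn_iff.1 huc η hη
  obtain ⟨n, hn⟩ := exists_nat_gt ((t : ℝ) / r)
  have hn0 : 0 < n := by
    have : (0 : ℝ) < n := lt_of_le_of_lt (by positivity) hn
    exact_mod_cast this
  have hn1 : (t : ℝ) / n < r := by
    rw [div_lt_iff₀ (by exact_mod_cast hn0)]
    rwa [div_lt_iff₀ hr, mul_comm] at hn
  refine ⟨StepFunction.interpolate g t n, ?_⟩
  have hstep : eLpNorm (fun s => (StepFunction.interpolate g t n).toFun s - g s) 2 μ ≤ δ := by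
    refine (eLpNorm_le_of_ae_bound (C := η) ?_).trans hηδ
    rw [hμ, ae_restrict_iff' measurableSet_Ioc]
    refine ae_of_all _ fun s hs => ?_
    obtain ⟨q, hq, hqs, hqg⟩ := StepFunction.interpolate_toFun g hn0 hs
    rw [hqg, ← dist_eq_norm]
    exact (hrη q hq s ⟨hs.1.le, hs.2⟩ (by rw [Real.dist_eq]; linarith)).le
  have hmeas : AEStronglyMeasurable
      (fun s => (StepFunction.interpolate g t n).toFun s - g s) μ := by
    refine AEStronglyMeasurable.sub (Measurable.aestronglyMeasurable ?_) hg.aestronglyMeasurable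
    unfold StepFunction.toFun
    exact Finset.measurable_sum _ fun k _ => measurable_const.indicator measurableSet_Ioc
  rw [eLpNorm_sub_comm] at hgσ
  have := hδε _ _ hmeas (hg.aestronglyMeasurable.sub hσ.1) hstep hgσ
  refine le_trans (le_of_eq (congrArg (fun h => eLpNorm h 2 μ) ?_)) this.le
  ext s
  simp

lemma exists_seq_stepFunction_tendsto {σ : ℝ → ℝ} {t : ℝ≥0}
    (hσ : MemLp σ 2 (volume.restrict (Set.Icc (0 : ℝ) t))) :
    ∃ g : ℕ → StepFunction, Tendsto (fun n => eLpNorm (fun s => (g n).toFun s - σ s) 2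
      (volume.restrict (Set.Icc (0 : ℝ) t))) atTop (𝓝 0) := by
  choose g hg using fun n : ℕ => exists_stepFunction_eLpNorm_sub_le hσ
    (ε := ((n : ℝ≥0∞) + 1)⁻¹) (by simp)
  refine ⟨g, tendsto_of_tendsto_of_tendsto_of_le_of_le tendsto_const_nhds ?_
    (fun _ => zero_le) hg⟩
  exact_mod_cast (tendsto_add_atTop_iff_nat 1).2 ENNReal.tendsto_inv_nat_nhds_zero

/-! ### Stochastic integrals as functionals of the increments -/

lemma StepFunction.integral_eq_integral_increments {d : ℕ} {Ω : Type*} (g : StepFunction)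
    (B : ℝ≥0 → Ω → Particle d) (t : ℝ≥0) (ω : Ω) :
    g.integral B t ω = g.integral (fun u w => w u) t (fun u => B u ω - B 0 ω) := by
  simp [integral]

lemma StepFunction.measurable_integral {d : ℕ} {Ω : Type*} [MeasurableSpace Ω] (g : StepFunction)
    {B : ℝ≥0 → Ω → Particle d} (hB : ∀ u, Measurable (B u)) (t : ℝ≥0) :
    Measurable (g.integral B t) := by
  unfold integral
  exact Finset.measurable_sum _ fun k _ => ((hB _).sub (hB _)).const_smul (g.coeff k)

/-- Finitely many stochastic integrals of the same deterministic integrand are one and the same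
measurable functional of the increments of their integrators. -/
lemma exists_measurable_functional {d : ℕ} {ι Ω : Type*} [Finite ι] {mΩ : MeasurableSpace Ω}
    {P : Measure Ω} {σ : ℝ → ℝ} {B : ι → ℝ≥0 → Ω → Particle d} {t : ℝ≥0}
    {I : ι → Ω → Particle d} (hB : ∀ i u, Measurable (B i u))
    (hI : ∀ i, AEStronglyMeasurable (I i) P) (h : ∀ i, IsStochasticIntegral P σ (B i) t (I i)) :
    ∃ Ψ : (ℝ≥0 → Particle d) → Particle d, Measurable Ψ ∧
      ∀ i, I i =ᵐ[P] fun ω => Ψ (fun u => B i u ω - B i 0 ω) := by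
  have := Fintype.ofFinite ι
  cases isEmpty_or_nonempty ι with
  | inl _ => exact ⟨0, measurable_const, fun i => isEmptyElim i⟩
  | inr hne =>
    obtain ⟨i₀⟩ := hne
    obtain ⟨g, hg⟩ := exists_seq_stepFunction_tendsto (h i₀).memLp
    have hmeas : ∀ n i, AEStronglyMeasurable (fun ω => (g n).integral (B i) t ω - I i ω) P :=
      fun n i => ((g n).measurable_integral (hB i) t).aestronglyMeasurable.sub (hI i)
    -- Summing the errors over all `i` yields one subsequence along which every integral converges
    -- almost surely, so that `Ψ` does not depend on `i`.
    have hlim : Tendsto (fun n => eLpNorm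
        ((∑ i, fun ω => ‖(g n).integral (B i) t ω - I i ω‖) - (0 : Ω → ℝ)) 2 P) atTop (𝓝 0) := by
      have hsum : Tendsto (fun n => ∑ i, eLpNorm (fun ω => (g n).integral (B i) t ω - I i ω) 2 P)
          atTop (𝓝 0) := by
        simpa using tendsto_finsetSum Finset.univ fun i _ => (h i).tendsto g hg
      refine tendsto_of_tendsto_of_tendsto_of_le_of_le tendsto_const_nhds hsum
        (fun _ => zero_le) fun n => ?_
      simp only [sub_zero]
      refine (eLpNorm_sum_le (fun i _ => (hmeas n i).norm) (by norm_num)).trans_eq ?_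
      exact Finset.sum_congr rfl fun i _ => eLpNorm_norm _
    obtain ⟨ns, -, hns⟩ := (tendstoInMeasure_of_tendsto_eLpNorm (by norm_num)
      (fun n => Finset.aestronglyMeasurable_sum _ fun i _ => (hmeas n i).norm)
      aestronglyMeasurable_const hlim).exists_seq_tendsto_ae
    refine ⟨fun w => limUnder atTop fun n => (g (ns n)).integral (fun u w => w u) t w, ?_, ?_⟩
    · exact (StronglyMeasurable.limUnder fun n => ((g (ns n)).measurable_integral
        (fun u => measurable_pi_apply u) t).stronglyMeasurable).measurable
    · intro i
      filter_upwards [hns] with ω hω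
      simp_rw [← StepFunction.integral_eq_integral_increments]
      refine (Tendsto.limUnder_eq (tendsto_iff_norm_sub_tendsto_zero.2 ?_)).symm
      refine tendsto_of_tendsto_of_tendsto_of_le_of_le tendsto_const_nhds hω
        (fun _ => norm_nonneg _) fun n => ?_
      simp only [Finset.sum_apply]
      exact Finset.single_le_sum (f := fun i => ‖(g (ns n)).integral (B i) t ω - I i ω‖)
        (fun _ _ => norm_nonneg _) (Finset.mem_univ i)

/-! ### Exchangeability of the driving data -/

lemma IsIndepWienerFamily.measurable {d N : ℕ} {Ω : Type*} {mΩ : MeasurableSpace Ω}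
    {P : Measure Ω} {ℱ : Filtration ℝ≥0 mΩ} {B : Fin N → ℝ≥0 → Ω → Particle d}
    (hB : IsIndepWienerFamily P ℱ B) (i : Fin N) (u : ℝ≥0) : Measurable (B i u) :=
  (hB.adapted i u).mono (ℱ.le u) le_rfl

/-- The coordinate processes are independent with the same law, because Brownian finite-dimensional
laws determine it; permuting the particles merely reindexes this family. -/
lemma IsIndepWienerFamily.identDistrib_increments {d N : ℕ} {Ω : Type*} {mΩ : MeasurableSpace Ω}
    {P : Measure Ω} [IsProbabilityMeasure P] {ℱ : Filtration ℝ≥0 mΩ}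
    {B : Fin N → ℝ≥0 → Ω → Particle d} (hB : IsIndepWienerFamily P ℱ B)
    (τ : Equiv.Perm (Fin N)) :
    IdentDistrib (fun ω i u => B (τ i) u ω - B (τ i) 0 ω) (fun ω i u => B i u ω - B i 0 ω) P P := by
  have hcoord : ∀ i u k, Measurable fun ω => B i u ω k := fun i u k =>
    (EuclideanSpace.proj (𝕜 := ℝ) k).continuous.measurable.comp (hB.measurable i u)
  have h1 : IdentDistrib (fun ω (p : Fin N × Fin d) (u : ℝ≥0) => B (τ p.1) u ω p.2)
      (fun ω (p : Fin N × Fin d) (u : ℝ≥0) => B p.1 u ω p.2) P P := by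
    refine IdentDistrib.pi (X := fun (p : Fin N × Fin d) ω (u : ℝ≥0) => B (τ p.1) u ω p.2)
      (Y := fun (p : Fin N × Fin d) ω (u : ℝ≥0) => B p.1 u ω p.2) (fun p => ?_) ?_ hB.indep
    · refine (identDistrib_iff_forall_finset_identDistrib
        (X := fun (u : ℝ≥0) ω => B (τ p.1) u ω p.2) (Y := fun (u : ℝ≥0) ω => B p.1 u ω p.2)
        (measurable_pi_lambda _ fun u => hcoord _ u _).aemeasurable
        (measurable_pi_lambda _ fun u => hcoord _ u _).aemeasurable).2 fun J => ?_
      exact ((hB.brownian (τ p.1) p.2).hasLaw J).identDistrib ((hB.brownian p.1 p.2).hasLaw J)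
    · exact hB.indep.precomp (g := fun p : Fin N × Fin d => (τ p.1, p.2))
        (fun p q hpq => by simpa [Prod.ext_iff] using hpq)
  have hΦ : Measurable fun (x : Fin N × Fin d → ℝ≥0 → ℝ) (i : Fin N) (u : ℝ≥0) =>
      (WithLp.toLp 2 fun k => x (i, k) u - x (i, k) 0 : Particle d) :=
    measurable_pi_lambda _ fun i => measurable_pi_lambda _ fun u =>
      (MeasurableEquiv.toLp 2 (Fin d → ℝ)).measurable.comp (by fun_prop)
  exact h1.comp hΦ

lemma identDistrib_comp_perm {ι E Ω : Type*} [Fintype ι] [MeasurableSpace E]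
    {mΩ : MeasurableSpace Ω} {P : Measure Ω} {μ : Measure E} [SigmaFinite μ] {Y : ι → Ω → E}
    (hY : HasLaw (fun ω i => Y i ω) (Measure.pi fun _ => μ) P) (τ : Equiv.Perm ι) :
    IdentDistrib (fun ω i => Y (τ i) ω) (fun ω i => Y i ω) P P := by
  refine HasLaw.identDistrib (κ := Measure.pi fun _ => μ) ?_ hY
  -- `piCongrLeft` carries coordinate `i` to the image of `i`, so the inverse permutation is what
  -- produces `Y (τ i)` at `i`.
  have hτ := measurePreserving_piCongrLeft (fun _ : ι => μ) τ.symm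
  convert hτ.hasLaw.comp hY using 1
  ext ω i
  have := MeasurableEquiv.piCongrLeft_apply_apply (β := fun _ : ι => E) τ.symm
    (fun i => Y i ω) (τ i)
  simpa using this.symm

/-- The increments are independent of `ℱ 0`, hence of the initial states; two independent blocks,
each invariant under `τ`, are jointly invariant. -/
lemma IsIndepWienerFamily.identDistrib_prodMk {d N : ℕ} {Ω : Type*} {mΩ : MeasurableSpace Ω}
    {P : Measure Ω} [IsProbabilityMeasure P] {ℱ : Filtration ℝ≥0 mΩ}
    {B : Fin N → ℝ≥0 → Ω → Particle d} (hB : IsIndepWienerFamily P ℱ B)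
    {Y : Fin N → Ω → Particle d} (hY : ∀ i, Measurable[ℱ 0] (Y i)) {μ : Measure (Particle d)}
    [SigmaFinite μ] (hYlaw : HasLaw (fun ω i => Y i ω) (Measure.pi fun _ => μ) P)
    (τ : Equiv.Perm (Fin N)) :
    IdentDistrib
      (fun ω => ((fun i => Y (τ i) ω), fun (i : Fin N) (u : ℝ≥0) => B (τ i) u ω - B (τ i) 0 ω))
      (fun ω => ((fun i => Y i ω), fun (i : Fin N) (u : ℝ≥0) => B i u ω - B i 0 ω)) P P := by
  have hind : IndepFun (fun ω i => Y i ω) (fun ω (i : Fin N) (u : ℝ≥0) => B i u ω - B i 0 ω) P := by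
    rw [IndepFun_iff_Indep]
    have := hB.indep_past 0
    simp only [zero_add] at this
    exact indep_of_indep_of_le_left this
      (Measurable.comap_le (@measurable_pi_lambda _ _ _ (ℱ 0) _ _ hY))
  refine IdentDistrib.prodMk (identDistrib_comp_perm hYlaw τ) (hB.identDistrib_increments τ)
    ?_ hind
  exact hind.comp (φ := fun y i => y (τ i)) (ψ := fun w i => w (τ i))
    (measurable_pi_lambda _ fun i => measurable_pi_apply _)
    (measurable_pi_lambda _ fun i => measurable_pi_apply _)

/-! ### Laws are determined by injective images -/

/-- By the Lusin-Souslin theorem, the law of a random variable with values in a standard Borel space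
is determined by the law of its image under a measurable injection. -/
lemma identDistrib_of_injOn_comp {Ω C F : Type*} {mΩ : MeasurableSpace Ω} {P : Measure Ω}
    [MeasurableSpace C] [StandardBorelSpace C] [MeasurableSpace F]
    [MeasurableSpace.CountablySeparated F] {G : C → F} (hG : Measurable G) {S : Set C}
    (hS : MeasurableSet S) (hinj : Set.InjOn G S) {K K' : Ω → C} (hK : Measurable K)
    (hK' : Measurable K') (hKS : ∀ᵐ ω ∂P, K ω ∈ S) (hKS' : ∀ᵐ ω ∂P, K' ω ∈ S)
    (h : IdentDistrib (fun ω => G (K ω)) (fun ω => G (K' ω)) P P) : IdentDistrib K K' P P := by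
  refine ⟨hK.aemeasurable, hK'.aemeasurable, Measure.ext fun A hA => ?_⟩
  have himg : MeasurableSet (G '' (A ∩ S)) :=
    (hA.inter hS).image_of_measurable_injOn hG (hinj.mono Set.inter_subset_right)
  have key : ∀ {K : Ω → C}, (∀ᵐ ω ∂P, K ω ∈ S) →
      P (K ⁻¹' A) = P ((fun ω => G (K ω)) ⁻¹' (G '' (A ∩ S))) := by
    intro K hKS
    refine measure_congr ?_
    filter_upwards [hKS] with ω hω
    refine propext ⟨fun hA => ⟨K ω, ⟨hA, hω⟩, rfl⟩, ?_⟩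
    rintro ⟨x, ⟨hxA, hxS⟩, hx⟩
    have : x = K ω := hinj hxS hω hx
    exact show K ω ∈ A from this ▸ hxA
  rw [Measure.map_apply hK hA, Measure.map_apply hK' hA, key hKS, key hKS']
  exact h.measure_mem_eq himg

/-! ### Path space -/

section PathSpace

variable {E : Type*} [NormedAddCommGroup E] {T : ℝ≥0}

/-- The paths along which the drift is integrable. -/
def integrablePaths (T : ℝ≥0) (b : ℝ × E → E) : Set C(Set.Icc (0 : ℝ) T, E) :=
  {x | IntegrableOn (fun s => b (s, Set.IccExtend T.coe_nonneg x s)) (Set.Icc 0 T)}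

variable [NormedSpace ℝ E]

/-- The noise term `x t - ∫_0^t b s (x s) ds` of the path `x`, including the initial state. -/
noncomputable def noiseTerm (b : ℝ × E → E) (t : Set.Icc (0 : ℝ) T)
    (x : C(Set.Icc (0 : ℝ) T, E)) : E :=
  x t - ∫ s in (0 : ℝ)..t, b (s, Set.IccExtend T.coe_nonneg x s)

/-- Integrability of the drift makes the noise term continuous in time, so agreement at dense times
is agreement at all times, and pathwise uniqueness applies. -/
lemma injOn_noiseTerm (hT : 0 < T) {b : ℝ × E → E}
    (hb : ∀ T' : ℝ, T' < T → ∀ R : ℝ, ∃ L : ℝ≥0, ∀ t ∈ Set.Icc (0 : ℝ) T',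
      LipschitzOnWith L (fun x => b (t, x)) (Metric.closedBall 0 R))
    {q : ℕ → Set.Icc (0 : ℝ) T} (hq : DenseRange q) :
    Set.InjOn (fun (x : C(Set.Icc (0 : ℝ) T, E)) (n : ℕ) => noiseTerm b (q n) x)
      (integrablePaths T b) := by
  intro x hx y hy hxy
  have hcont : ∀ {z : C(Set.Icc (0 : ℝ) T, E)}, z ∈ integrablePaths T b →
      Continuous fun t => noiseTerm b t z := by
    intro z hz
    have h0 : IntegrableOn (fun s => b (s, Set.IccExtend T.coe_nonneg z s)) (Set.uIcc 0 T) := by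
      rw [Set.uIcc_of_le T.coe_nonneg]; exact hz
    have h1 := intervalIntegral.continuousOn_primitive_interval h0
    rw [Set.uIcc_of_le T.coe_nonneg] at h1
    exact z.continuous.sub (continuousOn_iff_continuous_domRestrict.1 h1)
  have hall : ∀ t, noiseTerm b t x = noiseTerm b t y := fun t =>
    congrFun (hq.equalizer (hcont hx) (hcont hy) hxy) t
  have heq := eqOn_of_sub_integral_eq (b := fun s x => b (s, x)) (NNReal.coe_pos.2 hT) hb
    (x.continuous.Icc_extend') (y.continuous.Icc_extend') hx hy fun t ht => by
      have := hall ⟨t, ht⟩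
      simp only [noiseTerm] at this
      rw [Set.IccExtend_of_mem _ _ ht, Set.IccExtend_of_mem _ _ ht]
      exact this
  ext t
  have := heq t.2
  rwa [Set.IccExtend_of_mem _ _ t.2, Set.IccExtend_of_mem _ _ t.2] at this

end PathSpace

section MeasurablePathSpace

variable {E : Type*} [NormedAddCommGroup E] [MeasurableSpace E] [BorelSpace E] {T : ℝ≥0}
  [MeasurableSpace C(Set.Icc (0 : ℝ) T, E)] [BorelSpace C(Set.Icc (0 : ℝ) T, E)]

/-- Evaluations at a dense sequence inject path space continuously into `ℕ → E`; between Polish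
spaces this is a measurable embedding. -/
lemma measurable_continuousMap_of_eval [SecondCountableTopology E] [CompleteSpace E]
    {Ω : Type*} [MeasurableSpace Ω]
    {K : Ω → C(Set.Icc (0 : ℝ) T, E)} (hK : ∀ s, Measurable fun ω => K ω s) : Measurable K := by
  have : Nonempty (Set.Icc (0 : ℝ) T) := ⟨⟨0, Set.left_mem_Icc.2 T.coe_nonneg⟩⟩
  have hemb : MeasurableEmbedding fun (x : C(Set.Icc (0 : ℝ) T, E)) (n : ℕ) =>
      x (TopologicalSpace.denseSeq _ n) := by
    refine Continuous.measurableEmbedding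
      (continuous_pi fun n => continuous_eval_const _) fun x y hxy => ?_
    refine ContinuousMap.coe_injective
      ((TopologicalSpace.denseRange_denseSeq _).equalizer x.continuous y.continuous ?_)
    ext n
    exact congrFun hxy n
  exact hemb.measurable_comp_iff.1 (measurable_pi_lambda _ fun n => hK _)

lemma exists_measurable_path [SecondCountableTopology E] [CompleteSpace E]
    {Ω : Type*} {mΩ : MeasurableSpace Ω}
    {P : Measure Ω} {X : ℝ≥0 → Ω → E} (hX : ∀ t, Measurable (X t))
    (hc : ∀ᵐ ω ∂P, ContinuousOn (fun t => X t ω) (Set.Iic T)) :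
    ∃ K : Ω → C(Set.Icc (0 : ℝ) T, E), Measurable K ∧
      ∀ᵐ ω ∂P, ∀ s : Set.Icc (0 : ℝ) T, K ω s = X (s : ℝ).toNNReal ω := by
  classical
  -- The set of discontinuous paths need not be measurable; it is enlarged to a measurable null set,
  -- on which the path is replaced by zero.
  obtain ⟨A, hAsub, hA, hPA⟩ := exists_measurable_superset_of_null (ae_iff.1 hc)
  have hcont : ∀ ω, ω ∉ A → Continuous fun s : Set.Icc (0 : ℝ) T => X (s : ℝ).toNNReal ω := by
    intro ω hω
    have hω' : ContinuousOn (fun t => X t ω) (Set.Iic T) := by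
      by_contra h
      exact hω (hAsub h)
    refine hω'.comp_continuous (by fun_prop) fun s => ?_
    exact Real.toNNReal_le_iff_le_coe.2 s.2.2
  refine ⟨fun ω => if h : ω ∈ A then 0 else ⟨_, hcont ω h⟩, ?_, ?_⟩
  · refine measurable_continuousMap_of_eval fun s => ?_
    convert (hX (s : ℝ).toNNReal).indicator hA.compl using 1
    ext ω
    by_cases h : ω ∈ A <;> simp [h]
  · have : ∀ᵐ ω ∂P, ω ∉ A := by rw [ae_iff]; simpa using hPA
    filter_upwards [this] with ω hω s
    simp [hω]

lemma measurable_prodMk_IccExtend :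
    Measurable fun p : C(Set.Icc (0 : ℝ) T, E) × ℝ => (p.2, Set.IccExtend T.coe_nonneg p.1 p.2) := by
  refine measurable_snd.prodMk (Continuous.measurable ?_)
  exact continuous_eval.comp
    (continuous_fst.prodMk ((continuous_projIcc (h := T.coe_nonneg)).comp continuous_snd))

lemma measurable_noiseTerm [NormedSpace ℝ E] [SecondCountableTopology E] {b : ℝ × E → E} (hb : Measurable b) (t : Set.Icc (0 : ℝ) T) :
    Measurable (noiseTerm (E := E) b t) := by
  refine Measurable.sub (continuous_eval_const t).measurable ?_
  simp only [intervalIntegral.integral_of_le t.2.1]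
  exact (StronglyMeasurable.integral_prod_right (f := fun (x : C(Set.Icc (0 : ℝ) T, E)) s =>
    b (s, Set.IccExtend T.coe_nonneg x s)) (hb.comp measurable_prodMk_IccExtend).stronglyMeasurable).measurable

lemma measurableSet_integrablePaths [SecondCountableTopology E] {b : ℝ × E → E} (hb : Measurable b) :
    MeasurableSet (integrablePaths T b) :=
  _root_.measurableSet_integrable (f := fun (x : C(Set.Icc (0 : ℝ) T, E)) s =>
    b (s, Set.IccExtend T.coe_nonneg x s)) (hb.comp measurable_prodMk_IccExtend).stronglyMeasurable

end MeasurablePathSpace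

/-! ### Exchangeability of the solution -/

lemma IsDenoisingSolution.exchangeable {d N : ℕ} {Ω : Type*} {mΩ : MeasurableSpace Ω}
    {P : Measure Ω} [IsProbabilityMeasure P] {ℱ : Filtration ℝ≥0 mΩ} {T : ℝ≥0}
    {f : ℝ → Particle d → Particle d} {σ : ℝ → ℝ} {ζ : ℝ → Particle d → ℝ}
    (hf : Measurable (Function.uncurry f)) (hσ : Measurable σ)
    (hζ : Measurable (Function.uncurry ζ))
    (hζ_density : ∀ t : ℝ, 0 ≤ t → t < T → IsScoreDensity (ζ t))
    (hLip : ∀ T' : ℝ, T' < T → ∀ R : ℝ, ∃ L : ℝ≥0, ∀ t ∈ Set.Icc (0 : ℝ) T',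
      LipschitzOnWith L (denoisingDrift f σ ζ t) (Metric.closedBall 0 R))
    {B X : Fin N → ℝ≥0 → Ω → Particle d} (hX : IsDenoisingSolution P ℱ T f σ ζ B X)
    {μ : Measure (Particle d)} [SigmaFinite μ]
    (hX_init : HasLaw (fun ω i => X i 0 ω) (Measure.pi fun _ => μ) P)
    (hT : 0 < T) {t : ℝ≥0} (ht : t ≤ T) : Exchangeable P fun i => X i t := by
  intro τ
  let _ : MeasurableSpace C(Set.Icc (0 : ℝ) T, Particle d) := borel _
  have _ : BorelSpace C(Set.Icc (0 : ℝ) T, Particle d) := ⟨rfl⟩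
  have hXmeas : ∀ i s, Measurable (X i s) := fun i s =>
    (hX.adapted i s).mono (ℱ.le s) le_rfl
  -- Cutting the drift off outside `[0, T)` makes it jointly measurable; the time `T` is negligible
  -- in every integral.
  set b : ℝ × Particle d → Particle d := (Set.Ico 0 (T : ℝ) ×ˢ Set.univ).indicator
    fun p => denoisingDrift f σ ζ p.1 p.2
  have hb : Measurable b := measurable_indicator_denoisingDrift hf hσ hζ hζ_density
  have hb_eq : ∀ s ∈ Set.Ico (0 : ℝ) T, ∀ x, b (s, x) = denoisingDrift f σ ζ s x :=
    fun s hs x => Set.indicator_of_mem (Set.mk_mem_prod hs (Set.mem_univ x)) _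
  have hbLip : ∀ T' : ℝ, T' < T → ∀ R : ℝ, ∃ L : ℝ≥0, ∀ t ∈ Set.Icc (0 : ℝ) T',
      LipschitzOnWith L (fun x => b (t, x)) (Metric.closedBall 0 R) := by
    intro T' hT' R
    obtain ⟨L, hL⟩ := hLip T' hT' R
    refine ⟨L, fun s hs => ?_⟩
    have : (fun x => b (s, x)) = denoisingDrift f σ ζ s :=
      funext (hb_eq s ⟨hs.1, hs.2.trans_lt hT'⟩)
    rw [this]
    exact hL s hs
  choose K hK hKX using fun i => exists_measurable_path (T := T) (hXmeas i) (hX.continuousOn i)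
  have hdrift : ∀ {i ω}, (∀ s : Set.Icc (0 : ℝ) T, K i ω s = X i (s : ℝ).toNNReal ω) →
      Set.EqOn (fun s => b (s, Set.IccExtend T.coe_nonneg (K i ω) s))
        (fun s => denoisingDrift f σ ζ s (X i s.toNNReal ω)) (Set.Ico 0 T) := by
    intro i ω h s hs
    simp only
    rw [hb_eq s hs, Set.IccExtend_of_mem _ _ (Set.Ico_subset_Icc_self hs), h]
  have hKint : ∀ i, ∀ᵐ ω ∂P, K i ω ∈ integrablePaths T b := by
    intro i
    filter_upwards [hKX i, hX.integrableOn i] with ω h1 h2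
    have h3 := ((integrableOn_Icc_iff_integrableOn_Ico (by simp)).1 h2).congr_fun (hdrift h1).symm
      measurableSet_Ico
    exact (integrableOn_Icc_iff_integrableOn_Ico (by simp)).2 h3
  have hnoise : ∀ (s : Set.Icc (0 : ℝ) T) i, ∀ᵐ ω ∂P, noiseTerm b s (K i ω) =
      X i (s : ℝ).toNNReal ω - ∫ r in (0 : ℝ)..s, denoisingDrift f σ ζ r (X i r.toNNReal ω) := by
    intro s i
    filter_upwards [hKX i] with ω h1
    rw [noiseTerm, h1 s]
    congr 1
    rw [intervalIntegral.integral_of_le s.2.1, intervalIntegral.integral_of_le s.2.1,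
      ← integral_Ico_eq_integral_Ioc, ← integral_Ico_eq_integral_Ioc]
    exact setIntegral_congr_fun measurableSet_Ico
      ((hdrift h1).mono (Set.Ico_subset_Ico_right s.2.2))
  have hΨ : ∀ s : Set.Icc (0 : ℝ) T, ∃ Ψ : (ℝ≥0 → Particle d) → Particle d, Measurable Ψ ∧
      ∀ i, (fun ω => noiseTerm b s (K i ω)) =ᵐ[P]
        fun ω => X i 0 ω + Ψ (fun u => B i u ω - B i 0 ω) := by
    intro s
    have hs : ((s : ℝ).toNNReal : ℝ) = s := Real.coe_toNNReal _ s.2.1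
    -- Measurability of the drift integral in `ω` is inherited from the noise term of the continuous
    -- version `K i`.
    have hmeas : ∀ i, AEStronglyMeasurable (fun ω => X i (s : ℝ).toNNReal ω - X i 0 ω -
        ∫ r in (0 : ℝ)..(s : ℝ).toNNReal, denoisingDrift f σ ζ r (X i r.toNNReal ω)) P := by
      intro i
      refine (((measurable_noiseTerm hb s).comp (hK i)).sub
        (hXmeas i 0)).aestronglyMeasurable.congr ?_
      filter_upwards [hnoise s i] with ω h
      simp only [Pi.sub_apply, Function.comp_apply, h, hs]
      abel
    obtain ⟨Ψ, hΨm, hΨ⟩ := exists_measurable_functional (fun i => hX.wiener.measurable i) hmeas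
      (fun i => hX.equation i (s : ℝ).toNNReal (Real.toNNReal_le_iff_le_coe.2 s.2.2))
    refine ⟨Ψ, hΨm, fun i => ?_⟩
    filter_upwards [hΨ i, hnoise s i] with ω h1 h2
    rw [h2, ← h1, hs]
    abel
  have : Nonempty (Set.Icc (0 : ℝ) T) := ⟨⟨0, Set.left_mem_Icc.2 T.coe_nonneg⟩⟩
  set q := TopologicalSpace.denseSeq (Set.Icc (0 : ℝ) T)
  choose Ψ hΨm hΨ using hΨ
  -- As `Ψ` is common to all particles, permuting the driving data permutes the noise terms, whose
  -- joint law is therefore invariant.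
  have hdata := (hX.wiener.identDistrib_prodMk (fun i => hX.adapted i 0) hX_init τ).comp
    (u := fun p (i : Fin N) (n : ℕ) => p.1 i + Ψ (q n) (p.2 i))
    (measurable_pi_lambda _ fun i => measurable_pi_lambda _ fun n =>
      ((measurable_pi_apply i).comp measurable_fst).add
        ((hΨm (q n)).comp ((measurable_pi_apply i).comp measurable_snd)))
  set G : (Fin N → C(Set.Icc (0 : ℝ) T, Particle d)) → Fin N → ℕ → Particle d :=
    fun x i n => noiseTerm b (q n) (x i)
  have hG : Measurable G := measurable_pi_lambda _ fun i => measurable_pi_lambda _ fun n =>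
    (measurable_noiseTerm hb (q n)).comp (measurable_pi_apply i)
  have hinj : Set.InjOn G (Set.univ.pi fun _ => integrablePaths T b) := fun x hx y hy hxy =>
    funext fun i => injOn_noiseTerm hT hbLip (TopologicalSpace.denseRange_denseSeq _)
      (hx i trivial) (hy i trivial) (congrFun hxy i)
  have hGae : ∀ τ : Equiv.Perm (Fin N), (fun ω => G fun i => K (τ i) ω) =ᵐ[P]
      fun ω i n => X (τ i) 0 ω + Ψ (q n) (fun u => B (τ i) u ω - B (τ i) 0 ω) := by
    intro τ
    have : ∀ᵐ ω ∂P, ∀ i n, noiseTerm b (q n) (K (τ i) ω) =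
        X (τ i) 0 ω + Ψ (q n) (fun u => B (τ i) u ω - B (τ i) 0 ω) :=
      ae_all_iff.2 fun i => ae_all_iff.2 fun n => hΨ (q n) (τ i)
    filter_upwards [this] with ω hω
    exact funext fun i => funext fun n => hω i n
  have hGK : ∀ τ : Equiv.Perm (Fin N), Measurable fun ω i => K (τ i) ω := fun τ =>
    measurable_pi_lambda _ fun i => hK (τ i)
  have hGident : IdentDistrib (fun ω => G fun i => K (τ i) ω) (fun ω => G fun i => K i ω) P P :=
    ((IdentDistrib.of_ae_eq (hG.comp (hGK τ)).aemeasurable (hGae τ)).trans hdata).trans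
      (IdentDistrib.of_ae_eq (hG.comp (hGK 1)).aemeasurable (hGae 1)).symm
  have hKident := identDistrib_of_injOn_comp hG
    (MeasurableSet.univ_pi fun _ => measurableSet_integrablePaths hb) hinj (hGK τ) (hGK 1)
    ((ae_all_iff.2 fun i => hKint (τ i)).mono fun ω h i _ => h i)
    ((ae_all_iff.2 fun i => hKint i).mono fun ω h i _ => h i) hGident
  have heval : Measurable fun (x : Fin N → C(Set.Icc (0 : ℝ) T, Particle d)) i =>
      x i ⟨t, t.2, ht⟩ := measurable_pi_lambda _ fun i =>
    (continuous_eval_const _).measurable.comp (measurable_pi_apply i)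
  have hXK : ∀ τ : Equiv.Perm (Fin N), (fun ω i => X (τ i) t ω) =ᵐ[P]
      fun ω i => K (τ i) ω ⟨t, t.2, ht⟩ := by
    intro τ
    filter_upwards [ae_all_iff.2 fun i => hKX (τ i)] with ω hω
    funext i
    simp [hω i]
  have hXm : ∀ τ : Equiv.Perm (Fin N), AEMeasurable (fun ω i => X (τ i) t ω) P := fun τ =>
    (measurable_pi_lambda _ fun i => hXmeas (τ i) t).aemeasurable
  exact ((IdentDistrib.of_ae_eq (hXm τ) (hXK τ)).trans (hKident.comp heval)).trans
    (IdentDistrib.of_ae_eq (hXm 1) (hXK 1)).symm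

/-- A joint density of finitely many exchangeable random variables is symmetric. -/
lemma Exchangeable.density_comp_perm {ι Ω E : Type*} [Fintype ι] [MeasureSpace E]
    [SigmaFinite (volume : Measure E)] {mΩ : MeasurableSpace Ω} {P : Measure Ω}
    [IsFiniteMeasure P] {Y : ι → Ω → E} (hY : Exchangeable P Y) {ϱ : (ι → E) → ℝ≥0∞}
    (hϱ : Measurable ϱ) (hmap : P.map (fun ω i => Y i ω) = volume.withDensity ϱ)
    (τ : Equiv.Perm ι) : (fun x => ϱ (fun i => x (τ i))) =ᵐ[volume] ϱ := by
  have hτ := (volume_measurePreserving_piCongrLeft (fun _ : ι => E) τ)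
  have hτ_apply : ∀ (x : ι → E) i, MeasurableEquiv.piCongrLeft (fun _ : ι => E) τ x (τ i) = x i :=
    fun x i => MeasurableEquiv.piCongrLeft_apply_apply (β := fun _ : ι => E) τ x i
  have hperm : Measurable fun (x : ι → E) i => x (τ i) :=
    measurable_pi_lambda _ fun i => measurable_pi_apply _
  have hYm := (hY τ).aemeasurable_snd
  -- Finite mass is what makes the density unique almost everywhere.
  have hfin : ∫⁻ x, ϱ x ≠ ∞ := by
    rw [← setLIntegral_univ, ← withDensity_apply _ MeasurableSet.univ, ← hmap]
    exact measure_ne_top _ _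
  refine ((withDensity_eq_iff hϱ.aemeasurable (hϱ.comp hperm).aemeasurable hfin).1 ?_).symm
  -- Transport by `piCongrLeft` along `τ` turns `Y` into `Y ∘ τ⁻¹`, so exchangeability is used for
  -- `τ⁻¹`.
  have h1 : P.map (fun ω i => Y i ω) =
      (P.map fun ω i => Y i ω).map (MeasurableEquiv.piCongrLeft (fun _ : ι => E) τ) := by
    rw [AEMeasurable.map_map_of_aemeasurable (MeasurableEquiv.measurable _).aemeasurable hYm,
      ← (hY τ⁻¹).map_eq]
    congr 1
    ext ω i
    have := hτ_apply (fun i => Y i ω) (τ⁻¹ i)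
    simpa using this.symm
  rw [hmap] at h1
  rw [h1]
  ext A hA
  rw [Measure.map_apply (MeasurableEquiv.measurable _) hA,
    withDensity_apply _ ((MeasurableEquiv.measurable _) hA), withDensity_apply _ hA,
    ← hτ.setLIntegral_comp_preimage hA (hϱ.comp hperm)]
  refine lintegral_congr fun x => ?_
  simp only [Function.comp_apply, hτ_apply]

end MeanFieldSDE

theorem mainTheorem8 {d N : ℕ} {Ω : Type*} {mΩ : MeasurableSpace Ω} (P : Measure Ω)
    [IsProbabilityMeasure P] (ℱ : Filtration ℝ≥0 mΩ) (T : ℝ≥0)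
    (f : ℝ → MeanFieldSDE.Particle d → MeanFieldSDE.Particle d) (σ : ℝ → ℝ)
    (ζ : ℝ → MeanFieldSDE.Particle d → ℝ)
    (hf : Measurable (Function.uncurry f)) (hσ : Measurable σ)
    (hζ : Measurable (Function.uncurry ζ))
    (hζ_density : ∀ t : ℝ, 0 ≤ t → t < T → MeanFieldSDE.IsScoreDensity (ζ t))
    (hLip : ∀ T' : ℝ, T' < T → ∀ R : ℝ, ∃ L : ℝ≥0, ∀ t ∈ Set.Icc (0 : ℝ) T',
      LipschitzOnWith L (MeanFieldSDE.denoisingDrift f σ ζ t) (Metric.closedBall 0 R))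
    (B X : Fin N → ℝ≥0 → Ω → MeanFieldSDE.Particle d)
    (hX : MeanFieldSDE.IsDenoisingSolution P ℱ T f σ ζ B X)
    (hX_init : HasLaw (fun ω i => X i 0 ω)
      (Measure.pi (fun _ : Fin N => stdGaussian (MeanFieldSDE.Particle d))) P)
    (t : ℝ≥0) (ht_pos : 0 < t) (ht_le : t ≤ T) :
    MeanFieldSDE.Exchangeable P (fun i => X i t) ∧
      ∀ ϱ : (Fin N → MeanFieldSDE.Particle d) → ℝ≥0∞, Measurable ϱ →
        P.map (fun ω i => X i t ω) = volume.withDensity ϱ →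
        ∀ τ : Equiv.Perm (Fin N), (fun x => ϱ (fun i => x (τ i))) =ᵐ[volume] ϱ := by
  have h := hX.exchangeable hf hσ hζ hζ_density hLip hX_init (ht_pos.trans_le ht_le) ht_le
  exact ⟨h, fun ϱ hϱ hmap τ => h.density_comp_perm hϱ hmap τ⟩
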